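/- Computability is Kleene's S1--S9 computability for total arguments of pure finite type; $\{e\}(\Phi_1,\dots,\Phi_r)\simeq a$ means that the algorithm with index $e\in\mathbb{N}$ yields output $a\in\mathbb{N}$ on the arguments $\Phi_1,\dots,\Phi_r$. Fix a standard coding of rationals and of finite sequences of naturals by naturals. The Suslin functional $\mathsf{S}^2:\mathbb{N}^{\mathbb{N}}\to\{0,1\}$ is given by $$\mathsf{S}^2(h)=0\ \Longleftrightarrow\ (\exists g\in\mathbb{N}^{\mathbb{N}})(\forall n\in\mathbb{N})\,\big(h(\overline{g}n)=0\big),\qquad \overline{g}n=\langle g(0),\dots,g(n-1)\rangle .$$ A name of a real $r$ is an $\alpha\in\mathbb{N}^{\mathbb{N}}$ coding a sequence of rationals $(a_k)_{k\in\mathbb{N}}$ with $a_k\to r$ and $|a_k-a_{k+i}|\le 2^{-k}$ for all $k,i\in\mathbb{N}$. A functional $F:\mathbb{N}^{\mathbb{N}}\to\mathbb{N}$ represents a double sequence $(f_{n,m})_{n,m\in\mathbb{N}}$ of continuous functions $[0,1]\to\mathbb{R}$ if, for all $n,m$, all $x\in[0,1]$ and every name $\alpha$ of $x$, the sequence $k\mapsto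 F(n,m,k,\alpha(0),\alpha(1),\dots)$ is a name of $f_{n,m}(x)$. **Theorem.** For effectively Baire 2 functions $f:[0,1]\to[0,1]$, with the associated double sequence of continuous functions given as input, the supremum $\sup_{x\in[p,q]}f(x)$ is computable in $\mathsf{S}^2$ for rational $p\le q$ in $[0,1]$, uniformly in all inputs. That is, there is a single index $e\in\mathbb{N}$ such that the following holds. Let $f:[0,1]\to[0,1]$, let $(f_{n,m})_{n,m\in\mathbb{N}}$ be a double sequence of continuous functions $[0,1]\to\mathbb{R}$ with $$f(x)=\lim_{n\to\infty}\lim_{m\to\infty}f_{n,m}(x)\quad\text{for all }x\in[0,1]$$ (all these limits existing), let $F$ represent $(f_{n,m})_{n,m\in\mathbb{N}}$, and let $p\le q$ be rationals in $[0,1]$. Then, with $p$ and $q$ given by any of their codes, $\{e\}(\mathsf{S}^2,F,p,q,k)$ is defined for every $k\in\mathbb{N}$, and $k\mapsto\{e\}(\mathsf{S}^2,F,p,q,k)$ is a name of the real number $\sup_{x\in[p,q]}f(x)$. -/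

import Mathlib

open Filter Topology

namespace HigherType

/-- The (full, set-theoretic) pure finite types: type `0` is `ℕ` and type `k + 1` consists of all
total functionals from type `k` to `ℕ`. -/
def PureType : ℕ → Type
  | 0 => ℕ
  | k + 1 => PureType k → ℕ

/-- An argument of a computation: an object of some pure type. -/
abbrev Arg : Type := Σ k : ℕ, PureType k

/-- A natural number as an argument (of type `0`). -/
def arg0 (x : ℕ) : Arg := ⟨0, x⟩

/-- An element of Baire space as an argument (of type `1`). -/
def arg1 (α : ℕ → ℕ) : Arg := ⟨1, α⟩

/-- A functional `(ℕ → ℕ) → ℕ` as an argument (of type `2`). -/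
def arg2 (Y : (ℕ → ℕ) → ℕ) : Arg := ⟨2, Y⟩

/-- Kleene's computation relation `{e}(Φ) = a`, the least relation closed under the schemes S1-S9.
The number `e` is the index of an algorithm, `Φ` is a finite list of arguments of pure types, and
`a` is the output. An index is a pair of the number of the scheme and its parameters. -/
inductive Computes : ℕ → List Arg → ℕ → Prop
  /-- S1, successor: `{e}(x, Φ) = x + 1`. -/
  | S1 (x : ℕ) (Φ : List Arg) :
      Computes (Nat.pair 1 0) (arg0 x :: Φ) (x + 1)
  /-- S2, constants: `{e}(Φ) = q`. -/
  | S2 (q : ℕ) (Φ : List Arg) :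
      Computes (Nat.pair 2 q) Φ q
  /-- S3, projection: `{e}(x, Φ) = x`. -/
  | S3 (x : ℕ) (Φ : List Arg) :
      Computes (Nat.pair 3 0) (arg0 x :: Φ) x
  /-- S4, composition: `{e}(Φ) = {d}({c}(Φ), Φ)`. -/
  | S4 {d c y z : ℕ} {Φ : List Arg}
      (hc : Computes c Φ y) (hd : Computes d (arg0 y :: Φ) z) :
      Computes (Nat.pair 4 (Nat.pair d c)) Φ z
  /-- S5, primitive recursion, initial case: `{e}(0, Φ) = {d}(Φ)`. -/
  | S5_zero {d c y : ℕ} {Φ : List Arg}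
      (hd : Computes d Φ y) :
      Computes (Nat.pair 5 (Nat.pair d c)) (arg0 0 :: Φ) y
  /-- S5, primitive recursion, successor case: `{e}(x + 1, Φ) = {c}(x, {e}(x, Φ), Φ)`. -/
  | S5_succ {d c x y z : ℕ} {Φ : List Arg}
      (he : Computes (Nat.pair 5 (Nat.pair d c)) (arg0 x :: Φ) y)
      (hc : Computes c (arg0 x :: arg0 y :: Φ) z) :
      Computes (Nat.pair 5 (Nat.pair d c)) (arg0 (x + 1) :: Φ) z
  /-- S6, permutation: `{e}(Φ) = {d}(Φ')`, where `Φ'` arises from `Φ` by moving the argument at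
  position `i` to the front (these moves generate all permutations). -/
  | S6 {d y : ℕ} {Φ : List Arg} (i : ℕ) (hi : i < Φ.length)
      (hd : Computes d (Φ[i] :: Φ.eraseIdx i) y) :
      Computes (Nat.pair 6 (Nat.pair i d)) Φ y
  /-- S7, application at type `1`: `{e}(α, x, Φ) = α(x)`. -/
  | S7 (α : ℕ → ℕ) (x : ℕ) (Φ : List Arg) :
      Computes (Nat.pair 7 0) (arg1 α :: arg0 x :: Φ) (α x)
  /-- S8, application at type `k + 2`: `{e}(φ, Φ) = φ(λ ξ. {d}(ξ, φ, Φ))`, where `ξ` ranges over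
  type `k`; it is required that `{d}(ξ, φ, Φ)` is defined for every such `ξ`. -/
  | S8 {d k : ℕ} (φ : PureType (k + 2)) {Φ : List Arg} (g : PureType k → ℕ)
      (hd : ∀ ξ : PureType k, Computes d (⟨k, ξ⟩ :: ⟨k + 2, φ⟩ :: Φ) (g ξ)) :
      Computes (Nat.pair 8 d) (⟨k + 2, φ⟩ :: Φ) (φ g)
  /-- S9, enumeration: `{e}(x, Φ) = {x}(Φ₁, …, Φₘ)`, where `m` is at most the length of `Φ`. -/
  | S9 {x y : ℕ} {Φ : List Arg} (m : ℕ) (hm : m ≤ Φ.length)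
      (hx : Computes x (Φ.take m) y) :
      Computes (Nat.pair 9 m) (arg0 x :: Φ) y

theorem arg0_inj {x y : ℕ} (h : arg0 x = arg0 y) : x = y :=
  eq_of_heq (Sigma.mk.inj h).2

theorem arg1_inj {x y : ℕ → ℕ} (h : arg1 x = arg1 y) : x = y :=
  eq_of_heq (Sigma.mk.inj h).2

/-- The output of an algorithm on given arguments is unique, so that `{e}(Φ)` is a partial function. -/
theorem Computes.unique {e : ℕ} {Φ : List Arg} {a b : ℕ}
    (ha : Computes e Φ a) (hb : Computes e Φ b) : a = b := by
  induction ha generalizing b with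
  | S1 x Φ =>
    generalize he : Nat.pair 1 0 = e at hb
    generalize hl : arg0 x :: Φ = l at hb
    cases hb <;> simp only [Nat.pair_eq_pair] at he <;> try omega
    obtain rfl := arg0_inj (List.cons.inj hl).1
    rfl
  | S2 q Φ =>
    generalize he : Nat.pair 2 q = e at hb
    cases hb <;> simp_all [Nat.pair_eq_pair]
  | S3 x Φ =>
    generalize he : Nat.pair 3 0 = e at hb
    generalize hl : arg0 x :: Φ = l at hb
    cases hb <;> simp only [Nat.pair_eq_pair] at he <;> try omega
    obtain rfl := arg0_inj (List.cons.inj hl).1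
    rfl
  | @S4 d c y z Φ h1 h2 i1 i2 =>
    generalize he : Nat.pair 4 (Nat.pair d c) = e at hb
    cases hb <;> simp only [Nat.pair_eq_pair] at he <;> try omega
    obtain ⟨-, rfl, rfl⟩ := he
    rename_i h4 h3
    obtain rfl := i1 h3
    exact i2 h4
  | @S5_zero d c y Φ h i =>
    generalize he : Nat.pair 5 (Nat.pair d c) = e at hb
    generalize hl : arg0 0 :: Φ = l at hb
    cases hb <;> simp only [Nat.pair_eq_pair] at he <;> try omega
    · obtain ⟨-, rfl, rfl⟩ := he
      obtain ⟨-, rfl⟩ := List.cons.inj hl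
      exact i ‹_›
    · exact absurd (arg0_inj (List.cons.inj hl).1) (by omega)
  | @S5_succ d c x y z Φ h1 h2 i1 i2 =>
    generalize he : Nat.pair 5 (Nat.pair d c) = e at hb
    generalize hl : arg0 (x+1) :: Φ = l at hb
    cases hb <;> simp only [Nat.pair_eq_pair] at he <;> try omega
    · exact absurd (arg0_inj (List.cons.inj hl).1) (by omega)
    · obtain ⟨-, rfl, rfl⟩ := he
      obtain ⟨h, rfl⟩ := List.cons.inj hl
      have := arg0_inj h
      obtain rfl : x = _ := by simpa using this
      rename_i h4 h3
      obtain rfl := i1 h3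
      exact i2 h4
  | @S6 d y Φ i hi h ih =>
    generalize he : Nat.pair 6 (Nat.pair i d) = e at hb
    cases hb <;> simp only [Nat.pair_eq_pair] at he <;> try omega
    obtain ⟨-, rfl, rfl⟩ := he
    exact ih ‹_›
  | S7 α x Φ =>
    generalize he : Nat.pair 7 0 = e at hb
    generalize hl : arg1 α :: arg0 x :: Φ = l at hb
    cases hb <;> simp only [Nat.pair_eq_pair] at he <;> try omega
    obtain ⟨h1, h2⟩ := List.cons.inj hl
    obtain rfl := arg1_inj h1
    obtain rfl := arg0_inj (List.cons.inj h2).1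
    rfl
  | @S8 d k φ Φ g h ih =>
    generalize he : Nat.pair 8 d = e at hb
    generalize hl : (⟨k+2, φ⟩ : Arg) :: Φ = l at hb
    cases hb <;> simp only [Nat.pair_eq_pair] at he <;> try omega
    obtain ⟨-, rfl⟩ := he
    obtain ⟨h1, rfl⟩ := List.cons.inj hl
    obtain ⟨h2, h3⟩ := Sigma.mk.inj h1
    obtain rfl : k = _ := by simpa using h2
    obtain rfl := eq_of_heq h3
    congr 1
    funext ξ
    exact ih ξ (by apply_assumption)
  | @S9 x y Φ m hm h ih =>
    generalize he : Nat.pair 9 m = e at hb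
    generalize hl : arg0 x :: Φ = l at hb
    cases hb <;> simp only [Nat.pair_eq_pair] at he <;> try omega
    obtain ⟨-, rfl⟩ := he
    obtain ⟨h1, rfl⟩ := List.cons.inj hl
    obtain rfl := arg0_inj h1
    exact ih ‹_›

/-- The Suslin functional `S²`: for `f : ℕ → ℕ`, its value is `0` if there is `g : ℕ → ℕ` such that
`f` vanishes at (the code of) each initial segment `⟨g 0, …, g (n - 1)⟩`, and `1` otherwise. -/
noncomputable def suslin (f : ℕ → ℕ) : ℕ :=
  open Classical in
  if ∃ g : ℕ → ℕ, ∀ n : ℕ, f (Encodable.encode ((List.range n).map g)) = 0 then 0 else 1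

/-- The rational number with code `c = ⟨⟨a, b⟩, d⟩`, namely `(a - b) / (d + 1)`. -/
def ratOf (c : ℕ) : ℚ :=
  ((c.unpair.1.unpair.1 : ℚ) - (c.unpair.1.unpair.2 : ℚ)) / ((c.unpair.2 : ℚ) + 1)

/-- Every rational number has a code. -/
theorem ratOf_surjective : Function.Surjective ratOf := by
  intro r
  refine ⟨Nat.pair (Nat.pair r.num.toNat (-r.num).toNat) (r.den - 1), ?_⟩
  have h1 : ((r.num.toNat : ℤ) - ((-r.num).toNat : ℤ)) = r.num := by omega
  have h1' : ((r.num.toNat : ℚ) - ((-r.num).toNat : ℚ)) = (r.num : ℚ) := by exact_mod_cast h1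
  have h2 : (((r.den - 1 : ℕ) : ℚ) + 1) = (r.den : ℚ) := by
    have : r.den - 1 + 1 = r.den := Nat.sub_add_cancel r.den_pos
    exact_mod_cast this
  simp only [ratOf, Nat.unpair_pair]
  rw [h1', h2, Rat.num_div_den]

/-- `α : ℕ → ℕ` is (a code of) a fast-converging Cauchy sequence of rationals with limit `r`. -/
def IsName (α : ℕ → ℕ) (r : ℝ) : Prop :=
  (∀ k i : ℕ, |ratOf (α k) - ratOf (α (k + i))| ≤ 1 / 2 ^ k) ∧
    Tendsto (fun k : ℕ => (ratOf (α k) : ℝ)) atTop (𝓝 r)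

/-- The sequence `n, m, k, α 0, α 1, α 2, …`. -/
def prepend (n m k : ℕ) (α : ℕ → ℕ) : ℕ → ℕ
  | 0 => n
  | 1 => m
  | 2 => k
  | i + 3 => α i

/-- The type `2` functional `F` represents the double sequence `(f_{n,m})` of functions on `[0,1]`,
that is, uniformly in `n` and `m`, it maps each name of a point `x` in `[0,1]` to a name of
`f_{n,m}(x)`: the `k`-th entry of the latter is `F` at `n, m, k, α 0, α 1, …`, where `α` is the
given name of `x`. -/
def Represents (F : (ℕ → ℕ) → ℕ) (fs : ℕ → ℕ → C(unitInterval, ℝ)) : Prop :=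
  ∀ (n m : ℕ) (x : unitInterval) (α : ℕ → ℕ), IsName α (x : ℝ) →
    IsName (fun k : ℕ => F (prepend n m k α)) (fs n m x)

/-- `f(x) = lim_n lim_m f_{n,m}(x)` for all `x` in `[0,1]`, where all these limits exist; thus `f` is
effectively Baire 2, as witnessed by the double sequence `(f_{n,m})` of continuous functions. -/
def IsRepeatedLimit (fs : ℕ → ℕ → C(unitInterval, ℝ)) (f : unitInterval → ℝ) : Prop :=
  ∃ g : ℕ → unitInterval → ℝ,
    (∀ (n : ℕ) (x : unitInterval), Tendsto (fun m : ℕ => fs n m x) atTop (𝓝 (g n x))) ∧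
      ∀ x : unitInterval, Tendsto (fun n : ℕ => g n x) atTop (𝓝 (f x))

end HigherType

/-! ### Primitive recursive functions within Kleene's schemes -/

namespace HigherType

theorem Computes.moveFront {d y : ℕ} {A B : List Arg} {a : Arg}
    (h : Computes d (a :: (A ++ B)) y) :
    Computes (Nat.pair 6 (Nat.pair A.length d)) (A ++ a :: B) y := by
  refine Computes.S6 A.length (by simp) ?_
  simpa [List.eraseIdx_append_of_length_le] using h

/-- Moving the last entry of `B` to the front brings the next one to the same position, so one and
the same move, repeated `B.length` times, suffices. -/
theorem Computes.swapBlocks {d y : ℕ} {Φ : List Arg} (B : List Arg) :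
    ∀ A : List Arg, Computes d (B ++ (A ++ Φ)) y →
      Computes ((fun c => Nat.pair 6 (Nat.pair (A.length + B.length - 1) c))^[B.length] d)
        (A ++ (B ++ Φ)) y := by
  induction B using List.reverseRecOn with
  | nil => intro A h; simpa using h
  | append_singleton B b ih =>
    intro A h
    have h1 := ih (b :: A) (by simpa using h)
    have h2 : (b :: A).length + B.length - 1 = A.length + (B ++ [b]).length - 1 := by
      simp only [List.length_cons, List.length_append, List.length_nil]
      omega
    rw [h2] at h1
    have h3 : (A ++ B).length = A.length + (B ++ [b]).length - 1 := by simp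
    rw [List.length_append, List.length_singleton, Function.iterate_succ_apply']
    have h4 := Computes.moveFront (A := A ++ B) (B := Φ) (a := b) (by simpa using h1)
    simpa [add_assoc] using h4

/-- `f` is computed by some index on lists of numbers, whatever further arguments follow. -/
def Numeric {n : ℕ} (f : List.Vector ℕ n → ℕ) : Prop :=
  ∃ e : ℕ, ∀ (v : List.Vector ℕ n) (Φ : List Arg), Computes e (v.toList.map arg0 ++ Φ) (f v)

/-- S4 composes with one inner function only and puts its value in front. Composition with several
is iterated S4, where `Computes.swapBlocks` brings the original arguments back before the values
already computed. -/
theorem Numeric.bindArgs {n : ℕ} (gs : List (List.Vector ℕ n → ℕ)) :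
    (∀ g ∈ gs, Numeric g) → ∀ d : ℕ, ∃ e : ℕ, ∀ (v : List.Vector ℕ n) (Φ : List Arg) (y : ℕ),
      Computes d ((gs.map fun g => arg0 (g v)) ++ (v.toList.map arg0 ++ Φ)) y →
        Computes e (v.toList.map arg0 ++ Φ) y := by
  induction gs with
  | nil => exact fun _ d => ⟨d, fun v Φ y h => by simpa using h⟩
  | cons g gs ih =>
    intro hg d
    obtain ⟨c, hc⟩ := hg g (by simp)
    obtain ⟨e, he⟩ := ih (fun g' h' => hg g' (by simp [h'])) (Nat.pair 4 (Nat.pair d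
      ((fun c => Nat.pair 6 (Nat.pair (gs.length + n - 1) c))^[n] c)))
    refine ⟨e, fun v Φ y h => he v Φ y (Computes.S4 (y := g v) ?_ (by simpa using h))⟩
    have := Computes.swapBlocks (v.toList.map arg0) (gs.map fun g => arg0 (g v))
      (hc v ((gs.map fun g => arg0 (g v)) ++ Φ))
    simpa using this

theorem Numeric.of_primrec' {n : ℕ} {f : List.Vector ℕ n → ℕ} (hf : Nat.Primrec' f) :
    Numeric f := by
  induction hf with
  | zero => exact ⟨Nat.pair 2 0, fun v Φ => Computes.S2 0 _⟩
  | succ =>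
    refine ⟨Nat.pair 1 0, fun v Φ => ?_⟩
    rw [← v.cons_head_tail]
    exact Computes.S1 _ _
  | @get n i =>
    refine ⟨Nat.pair 6 (Nat.pair i (Nat.pair 3 0)), fun v Φ => ?_⟩
    have hi : (i : ℕ) < (v.toList.map arg0 ++ Φ).length := by simp; omega
    refine Computes.S6 i hi ?_
    have : (v.toList.map arg0 ++ Φ)[(i : ℕ)] = arg0 (v.get i) := by
      rw [List.getElem_append_left (by simp)]
      simp [List.Vector.get_eq_get_toList]
    rw [this]
    exact Computes.S3 _ _
  | @comp m n f g _ _ ihf ihg =>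
    obtain ⟨d, hd⟩ := ihf
    obtain ⟨e, he⟩ := Numeric.bindArgs (List.ofFn g) (by simpa [List.mem_ofFn] using ihg) d
    refine ⟨e, fun v Φ => he v Φ _ ?_⟩
    have := hd (List.Vector.ofFn fun i => g i v) (v.toList.map arg0 ++ Φ)
    simpa [List.Vector.toList_ofFn, List.map_ofFn, Function.comp_def] using this
  | @prec n f g _ _ ihf ihg =>
    obtain ⟨d, hd⟩ := ihf
    obtain ⟨c, hc⟩ := ihg
    refine ⟨Nat.pair 5 (Nat.pair d c), fun v Φ => ?_⟩
    rw [← v.cons_head_tail]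
    generalize v.head = x, v.tail = w
    simp only [List.Vector.head_cons, List.Vector.tail_cons, List.Vector.toList_cons,
      List.map_cons, List.cons_append]
    induction x with
    | zero => exact Computes.S5_zero (hd w Φ)
    | succ x ih => exact Computes.S5_succ ih (by simpa using hc (x ::ᵥ _ ::ᵥ w) Φ)

theorem Numeric.of_primrec {n : ℕ} {f : List.Vector ℕ n → ℕ} (hf : Primrec f) : Numeric f :=
  Numeric.of_primrec' (Nat.Primrec'.of_prim hf)

end HigherType

/-! ### Arithmetic on codes of rationals -/

namespace HigherType

/-- A code of `a / 2 ^ k`. -/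
def dyadic (a k : ℕ) : ℕ := Nat.pair (Nat.pair a 0) (2 ^ k - 1)

theorem ratOf_dyadic (a k : ℕ) : ratOf (dyadic a k) = a / 2 ^ k := by
  have h : ((2 ^ k - 1 : ℕ) : ℚ) + 1 = 2 ^ k := by
    have : 2 ^ k - 1 + 1 = 2 ^ k := Nat.sub_add_cancel Nat.one_le_two_pow
    exact_mod_cast this
  simp only [ratOf, dyadic, Nat.unpair_pair, h]
  simp

/-- A code of the sum of the rationals with codes `x` and `y`. -/
def addCode (x y : ℕ) : ℕ :=
  Nat.pair
    (Nat.pair (x.unpair.1.unpair.1 * (y.unpair.2 + 1) + y.unpair.1.unpair.1 * (x.unpair.2 + 1))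
      (x.unpair.1.unpair.2 * (y.unpair.2 + 1) + y.unpair.1.unpair.2 * (x.unpair.2 + 1)))
    ((x.unpair.2 + 1) * (y.unpair.2 + 1) - 1)

theorem ratOf_addCode (x y : ℕ) : ratOf (addCode x y) = ratOf x + ratOf y := by
  have h : (((x.unpair.2 + 1) * (y.unpair.2 + 1) - 1 : ℕ) : ℚ) + 1
      = ((x.unpair.2 : ℚ) + 1) * ((y.unpair.2 : ℚ) + 1) := by
    have : (x.unpair.2 + 1) * (y.unpair.2 + 1) - 1 + 1 = (x.unpair.2 + 1) * (y.unpair.2 + 1) :=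
      Nat.sub_add_cancel (Nat.mul_pos (Nat.succ_pos _) (Nat.succ_pos _))
    exact_mod_cast this
  have hx : (x.unpair.2 : ℚ) + 1 ≠ 0 := by positivity
  have hy : (y.unpair.2 : ℚ) + 1 ≠ 0 := by positivity
  simp only [ratOf, addCode, Nat.unpair_pair, h]
  push_cast
  field_simp
  ring

/-- Cross-multiplying and moving the subtracted parts across leaves a comparison of naturals without
subtraction, which is visibly primitive recursive. -/
theorem ratOf_le_iff (x y : ℕ) : ratOf x ≤ ratOf y ↔
    x.unpair.1.unpair.1 * (y.unpair.2 + 1) + y.unpair.1.unpair.2 * (x.unpair.2 + 1) ≤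
      y.unpair.1.unpair.1 * (x.unpair.2 + 1) + x.unpair.1.unpair.2 * (y.unpair.2 + 1) := by
  have hx : (0 : ℚ) < (x.unpair.2 : ℚ) + 1 := by positivity
  have hy : (0 : ℚ) < (y.unpair.2 : ℚ) + 1 := by positivity
  rw [ratOf, ratOf, div_le_div_iff₀ hx hy, ← Nat.cast_le (α := ℚ)]
  push_cast
  constructor <;> intro h <;> linarith

section Primrec

variable {α : Type*} [Primcodable α] {f g : α → ℕ}

theorem primrec_fst (hf : Primrec f) : Primrec fun a => (f a).unpair.1 :=
  Primrec.fst.comp (Primrec.unpair.comp hf)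

theorem primrec_snd (hf : Primrec f) : Primrec fun a => (f a).unpair.2 :=
  Primrec.snd.comp (Primrec.unpair.comp hf)

theorem primrec_two_pow (hf : Primrec f) : Primrec fun a => 2 ^ f a := by
  have h : Primrec₂ ((· ^ ·) : ℕ → ℕ → ℕ) := Primrec₂.unpaired'.1 Nat.Primrec.pow
  exact h.comp (Primrec.const 2) hf

theorem primrec_dyadic (hf : Primrec f) (hg : Primrec g) :
    Primrec fun a => dyadic (f a) (g a) :=
  Primrec₂.natPair.comp (Primrec₂.natPair.comp hf (Primrec.const 0))
    (Primrec.nat_sub.comp (primrec_two_pow hg) (Primrec.const 1))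

theorem primrec_mul_succ (hf : Primrec f) (hg : Primrec g) :
    Primrec fun a => f a * (g a + 1) :=
  Primrec.nat_mul.comp hf (Primrec.succ.comp hg)

theorem primrec_addCode (hf : Primrec f) (hg : Primrec g) :
    Primrec fun a => addCode (f a) (g a) :=
  Primrec₂.natPair.comp
    (Primrec₂.natPair.comp
      (Primrec.nat_add.comp (primrec_mul_succ (primrec_fst (primrec_fst hf)) (primrec_snd hg))
        (primrec_mul_succ (primrec_fst (primrec_fst hg)) (primrec_snd hf)))
      (Primrec.nat_add.comp (primrec_mul_succ (primrec_snd (primrec_fst hf)) (primrec_snd hg))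
        (primrec_mul_succ (primrec_snd (primrec_fst hg)) (primrec_snd hf))))
    (Primrec.nat_sub.comp (primrec_mul_succ (Primrec.succ.comp (primrec_snd hf)) (primrec_snd hg))
      (Primrec.const 1))

theorem primrecPred_ratOf_le (hf : Primrec f) (hg : Primrec g) :
    PrimrecPred fun a => ratOf (f a) ≤ ratOf (g a) :=
  PrimrecPred.of_eq
    (Primrec.nat_le.comp
      (Primrec.nat_add.comp (primrec_mul_succ (primrec_fst (primrec_fst hf)) (primrec_snd hg))
        (primrec_mul_succ (primrec_snd (primrec_fst hg)) (primrec_snd hf)))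
      (Primrec.nat_add.comp (primrec_mul_succ (primrec_fst (primrec_fst hg)) (primrec_snd hf))
        (primrec_mul_succ (primrec_snd (primrec_fst hf)) (primrec_snd hg))))
    fun a => (ratOf_le_iff (f a) (g a)).symm

theorem PrimrecPred.imp {p q : α → Prop} (hp : PrimrecPred p) (hq : PrimrecPred q) :
    PrimrecPred fun a => p a → q a :=
  (hp.not.or hq).of_eq fun a => by tauto

end Primrec

/-! ### The test on finite sequences and the search -/

/-- The sequence number with code `c`. -/
def seqOf (c : ℕ) : List ℕ := (Encodable.decode c).getD []

theorem seqOf_encode (l : List ℕ) : seqOf (Encodable.encode l) = l := by simp [seqOf]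

theorem primrec_seqOf {α : Type*} [Primcodable α] {f : α → ℕ} (hf : Primrec f) :
    Primrec fun a => seqOf (f a) :=
  Primrec.option_getD.comp (Primrec.decode.comp hf) (Primrec.const [])

/-- The first index `⟨n, ⟨m, t⟩⟩` tested at the sequence `l`. -/
def fstIndex (l : List ℕ) : ℕ := (l.length - 2).unpair.1

/-- The second index `⟨n, ⟨m, t⟩⟩` tested at the sequence `l`. -/
def sndIndex (l : List ℕ) : ℕ := (l.length - 2).unpair.2

/-- The code of a rational that the sequence `l` assigns to the index `a`. -/
def pointAt (l : List ℕ) (a : ℕ) : ℕ := (l.getD (a + 1) 0).unpair.2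

/-- The bound for `m` that the sequence `l` assigns to `n`. -/
def boundAt (l : List ℕ) (n : ℕ) : ℕ := (l.getD (n + 1) 0).unpair.1

/-- The argument at which the representing functional is evaluated at the sequence `l`. -/
def query (l : List ℕ) : ℕ → ℕ :=
  prepend (fstIndex l).unpair.1 (fstIndex l).unpair.2.unpair.1 (fstIndex l).unpair.2.unpair.2
    fun _ => pointAt l (fstIndex l)

/-- The sequence `l` passes the test at its pair of indices: the points lie between `p` and `q` and
satisfy the Cauchy condition, and the approximate value `v` at the first point is at least `c`, up
to the precision of the index. -/
def Passes (v c p q : ℕ) (l : List ℕ) : Prop :=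
  2 ≤ l.length →
    (ratOf p ≤ ratOf (pointAt l (fstIndex l)) ∧ ratOf (pointAt l (fstIndex l)) ≤ ratOf q) ∧
    ratOf (pointAt l (fstIndex l)) ≤ ratOf (addCode (pointAt l (sndIndex l))
      (addCode (dyadic 1 (fstIndex l).unpair.2.unpair.2)
        (dyadic 1 (sndIndex l).unpair.2.unpair.2))) ∧
    (l.getD 0 0 ≤ (fstIndex l).unpair.1 →
      boundAt l (fstIndex l).unpair.1 ≤ (fstIndex l).unpair.2.unpair.1 →
      ratOf c ≤ ratOf (addCode v (dyadic 2 (fstIndex l).unpair.2.unpair.2)))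

section Primrec

variable {α : Type*} [Primcodable α] {L : α → List ℕ}

theorem primrec_fstIndex (hL : Primrec L) : Primrec fun a => fstIndex (L a) :=
  primrec_fst (Primrec.nat_sub.comp (Primrec.list_length.comp hL) (Primrec.const 2))

theorem primrec_sndIndex (hL : Primrec L) : Primrec fun a => sndIndex (L a) :=
  primrec_snd (Primrec.nat_sub.comp (Primrec.list_length.comp hL) (Primrec.const 2))

theorem primrec_pointAt (hL : Primrec L) {f : α → ℕ} (hf : Primrec f) :
    Primrec fun a => pointAt (L a) (f a) :=
  primrec_snd ((Primrec.list_getD 0).comp hL (Primrec.succ.comp hf))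

theorem primrec_boundAt (hL : Primrec L) {f : α → ℕ} (hf : Primrec f) :
    Primrec fun a => boundAt (L a) (f a) :=
  primrec_fst ((Primrec.list_getD 0).comp hL (Primrec.succ.comp hf))

theorem primrec_query (hL : Primrec L) {f : α → ℕ} (hf : Primrec f) :
    Primrec fun a => query (L a) (f a) := by
  have hi := primrec_fstIndex hL
  have h : ∀ j, PrimrecPred fun a => f a = j := fun j => Primrec.eq.comp hf (Primrec.const j)
  refine (Primrec.ite (h 0) (primrec_fst hi) (Primrec.ite (h 1) (primrec_fst (primrec_snd hi))
    (Primrec.ite (h 2) (primrec_snd (primrec_snd hi)) (primrec_pointAt hL hi)))).of_eq fun a => ?_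
  rcases f a with _ | _ | _ | j <;> simp [query, prepend]

theorem primrecPred_passes (hL : Primrec L) {v c p q : α → ℕ} (hv : Primrec v) (hc : Primrec c)
    (hp : Primrec p) (hq : Primrec q) :
    PrimrecPred fun a => Passes (v a) (c a) (p a) (q a) (L a) := by
  have hi := primrec_fstIndex hL
  have hj := primrec_sndIndex hL
  have ht := primrec_snd (primrec_snd hi)
  refine PrimrecPred.imp (Primrec.nat_le.comp (Primrec.const 2) (Primrec.list_length.comp hL))
    (((primrecPred_ratOf_le hp (primrec_pointAt hL hi)).and
      (primrecPred_ratOf_le (primrec_pointAt hL hi) hq)).and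
    ((primrecPred_ratOf_le (primrec_pointAt hL hi) (primrec_addCode (primrec_pointAt hL hj)
      (primrec_addCode (primrec_dyadic (Primrec.const 1) ht)
        (primrec_dyadic (Primrec.const 1) (primrec_snd (primrec_snd hj)))))).and
    (PrimrecPred.imp (Primrec.nat_le.comp ((Primrec.list_getD 0).comp hL (Primrec.const 0))
      (primrec_fst hi))
    (PrimrecPred.imp (Primrec.nat_le.comp (primrec_boundAt hL (primrec_fst hi))
      (primrec_fst (primrec_snd hi)))
    (primrecPred_ratOf_le hc (primrec_addCode hv (primrec_dyadic (Primrec.const 2) ht)))))))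

end Primrec

open Classical in
/-- The function to which the Suslin functional is applied: it vanishes at the codes of the
sequences that pass the test, where `F` provides the values. -/
noncomputable def testFun (F : (ℕ → ℕ) → ℕ) (c p q : ℕ) (l : ℕ) : ℕ :=
  if Passes (F (query (seqOf l))) c p q (seqOf l) then 0 else 1

/-- The greatest `i ≤ N` such that `i / 2 ^ (k + 1)` is accepted by the Suslin functional, or `0` if
there is none. -/
noncomputable def supIndex (F : (ℕ → ℕ) → ℕ) (p q k : ℕ) : ℕ → ℕ
  | 0 => 0
  | i + 1 => if suslin (testFun F (dyadic (i + 1) (k + 1)) p q) = 0 then i + 1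
      else supIndex F p q k i

/-- The name of the supremum produced by the algorithm. -/
noncomputable def supName (F : (ℕ → ℕ) → ℕ) (p q k : ℕ) : ℕ :=
  dyadic (supIndex F p q k (2 ^ (k + 1))) (k + 1)

/-! ### Indices for the algorithm -/

/-- The index for moving the argument at position `i` to the front and continuing with `d`. -/
def moveIdx (i d : ℕ) : ℕ := Nat.pair 6 (Nat.pair i d)

theorem computes_query : ∃ e : ℕ, ∀ (l j : ℕ) (Φ : List Arg),
    Computes e (arg0 l :: arg0 j :: Φ) (query (seqOf l) j) := by
  obtain ⟨e, he⟩ := Numeric.of_primrec (n := 2)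
    (f := fun v => query (seqOf (v.get 0)) (v.get 1))
    (primrec_query (primrec_seqOf (Primrec.vector_get.comp .id (.const 0)))
      (Primrec.vector_get.comp .id (.const 1)))
  exact ⟨e, fun l j Φ => he (l ::ᵥ j ::ᵥ .nil) Φ⟩

open Classical in
theorem computes_passes : ∃ e : ℕ, ∀ (i p q k v l : ℕ) (Φ : List Arg),
    Computes e (arg0 i :: arg0 p :: arg0 q :: arg0 k :: arg0 v :: arg0 l :: Φ)
      (if Passes v (dyadic (i + 1) (k + 1)) p q (seqOf l) then 0 else 1) := by
  have hg : ∀ i : Fin 6, Primrec fun v : List.Vector ℕ 6 => v.get i :=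
    fun i => Primrec.vector_get.comp .id (.const i)
  obtain ⟨e, he⟩ := Numeric.of_primrec (n := 6)
    (f := fun v => if Passes (v.get 4) (dyadic (v.get 0 + 1) (v.get 3 + 1)) (v.get 1) (v.get 2)
      (seqOf (v.get 5)) then 0 else 1)
    (Primrec.ite (primrecPred_passes (primrec_seqOf (hg 5)) (hg 4)
      (primrec_dyadic (Primrec.succ.comp (hg 0)) (Primrec.succ.comp (hg 3))) (hg 1) (hg 2))
      (Primrec.const 0) (Primrec.const 1))
  exact ⟨e, fun i p q k v l Φ => he (i ::ᵥ p ::ᵥ q ::ᵥ k ::ᵥ v ::ᵥ l ::ᵥ .nil) Φ⟩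

/-- The order of the arguments is the one S8 for `suslin` produces inside the recursion S5; `y` is
the previous value of that recursion and plays no role here. -/
theorem computes_testFun : ∃ e : ℕ, ∀ (F : (ℕ → ℕ) → ℕ) (l i y p q k : ℕ),
    Computes e [arg0 l, arg2 suslin, arg0 i, arg0 y, arg2 F, arg0 p, arg0 q, arg0 k]
      (testFun F (dyadic (i + 1) (k + 1)) p q l) := by
  obtain ⟨a, ha⟩ := computes_query
  obtain ⟨d, hd⟩ := computes_passes
  -- With the value of `F` in front, `k`, `q`, `p` each stand at position 8 when their turn comes,
  -- and then `i` at position 6.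
  refine ⟨Nat.pair 4 (Nat.pair (moveIdx 8 (moveIdx 8 (moveIdx 8 (moveIdx 6 d))))
    (moveIdx 4 (Nat.pair 8 (moveIdx 2 a)))), fun F l i y p q k => ?_⟩
  refine Computes.S4 (y := F (query (seqOf l))) ?_ ?_
  · refine Computes.moveFront (A := [_, _, _, _]) ?_
    refine Computes.S8 (k := 0) F (query (seqOf l)) fun j => ?_
    exact Computes.moveFront (A := [_, _]) (ha l j _)
  · refine Computes.moveFront (A := [_, _, _, _, _, _, _, _]) (B := []) ?_
    refine Computes.moveFront (A := [_, _, _, _, _, _, _, _]) (B := []) ?_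
    refine Computes.moveFront (A := [_, _, _, _, _, _, _, _]) (B := []) ?_
    refine Computes.moveFront (A := [_, _, _, _, _, _]) ?_
    exact hd i p q k _ l _

theorem computes_supIndex : ∃ e : ℕ, ∀ (F : (ℕ → ℕ) → ℕ) (N p q k : ℕ),
    Computes e [arg0 N, arg2 suslin, arg2 F, arg0 p, arg0 q, arg0 k] (supIndex F p q k N) := by
  obtain ⟨a, ha⟩ := computes_testFun
  have hg : ∀ i : Fin 3, Primrec fun v : List.Vector ℕ 3 => v.get i :=
    fun i => Primrec.vector_get.comp .id (.const i)
  obtain ⟨d, hd⟩ := Numeric.of_primrec (n := 3)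
    (f := fun v => if v.get 0 = 0 then v.get 1 + 1 else v.get 2)
    (Primrec.ite (Primrec.eq.comp (hg 0) (Primrec.const 0)) (Primrec.succ.comp (hg 1)) (hg 2))
  refine ⟨Nat.pair 5 (Nat.pair (Nat.pair 2 0) (Nat.pair 4 (Nat.pair d
    (moveIdx 2 (Nat.pair 8 a))))), fun F N p q k => ?_⟩
  induction N with
  | zero => exact Computes.S5_zero (Computes.S2 0 _)
  | succ i ih =>
    refine Computes.S5_succ ih ?_
    refine Computes.S4 (y := suslin (testFun F (dyadic (i + 1) (k + 1)) p q)) ?_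
      (hd (_ ::ᵥ i ::ᵥ _ ::ᵥ .nil) _)
    refine Computes.moveFront (A := [_, _]) ?_
    exact Computes.S8 (k := 0) suslin _ fun l => ha F l i _ p q k

theorem computes_supName : ∃ e : ℕ, ∀ (F : (ℕ → ℕ) → ℕ) (p q k : ℕ),
    Computes e [arg2 suslin, arg2 F, arg0 p, arg0 q, arg0 k] (supName F p q k) := by
  obtain ⟨a, ha⟩ := computes_supIndex
  obtain ⟨b, hb⟩ := Numeric.of_primrec (n := 1) (f := fun v => 2 ^ (v.get 0 + 1))
    (primrec_two_pow (Primrec.succ.comp (Primrec.vector_get.comp .id (.const 0))))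
  obtain ⟨d, hd⟩ := Numeric.of_primrec (n := 2) (f := fun v => dyadic (v.get 1) (v.get 0 + 1))
    (primrec_dyadic (Primrec.vector_get.comp .id (.const 1))
      (Primrec.succ.comp (Primrec.vector_get.comp .id (.const 0))))
  refine ⟨Nat.pair 4 (Nat.pair (moveIdx 5 d) (Nat.pair 4 (Nat.pair a (moveIdx 4 b)))),
    fun F p q k => ?_⟩
  refine Computes.S4 (y := supIndex F p q k (2 ^ (k + 1))) (Computes.S4 (y := 2 ^ (k + 1)) ?_
    (ha F _ p q k)) ?_
  · exact Computes.moveFront (A := [_, _, _, _]) (B := []) (hb (k ::ᵥ .nil) _)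
  · exact Computes.moveFront (A := [_, _, _, _, _]) (B := []) (hd (k ::ᵥ _ ::ᵥ .nil) _)

end HigherType

/-! ### Names of reals and the meaning of the test -/

namespace HigherType

theorem tendsto_div_two_pow (c : ℝ) : Tendsto (fun t : ℕ => c / 2 ^ t) atTop (𝓝 0) := by
  have h := (tendsto_pow_atTop_nhds_zero_of_lt_one (r := (1 / 2 : ℝ)) (by norm_num)
    (by norm_num)).const_mul c
  simpa [div_eq_mul_inv] using h

theorem isName_const (y : ℕ) : IsName (fun _ => y) (ratOf y : ℝ) :=
  ⟨fun k i => by simp, tendsto_const_nhds⟩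

theorem IsName.abs_sub_le {α : ℕ → ℕ} {r : ℝ} (h : IsName α r) (k : ℕ) :
    |(ratOf (α k) : ℝ) - r| ≤ 1 / 2 ^ k := by
  have h1 : Tendsto (fun i => |(ratOf (α k) : ℝ) - ratOf (α (k + i))|) atTop
      (𝓝 |(ratOf (α k) : ℝ) - r|) := by
    have := h.2.comp (tendsto_add_atTop_nat k)
    refine ((tendsto_const_nhds.sub this).abs).congr fun i => ?_
    simp [add_comm]
  refine le_of_tendsto h1 (Eventually.of_forall fun i => ?_)
  have h2 := (Rat.cast_le (K := ℝ)).2 (h.1 k i)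
  push_cast at h2
  exact h2

/-- Approximations with precision `2 ^ (-k - 1)` form a name. -/
theorem isName_of_abs_sub_le {α : ℕ → ℕ} {r : ℝ}
    (h : ∀ k, |(ratOf (α k) : ℝ) - r| ≤ 1 / 2 ^ (k + 1)) : IsName α r := by
  constructor
  · intro k i
    have h1 : |(ratOf (α k) : ℝ) - ratOf (α (k + i))| ≤ 1 / 2 ^ k := by
      have hi : (1 : ℝ) / 2 ^ (k + i + 1) ≤ 1 / 2 ^ (k + 1) :=
        one_div_le_one_div_of_le (by positivity)
          (pow_le_pow_right₀ (by norm_num) (by omega))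
      have hk : (1 : ℝ) / 2 ^ (k + 1) + 1 / 2 ^ (k + 1) = 1 / 2 ^ k := by
        rw [pow_succ]
        field_simp
        norm_num
      have h2 := abs_sub_le (ratOf (α k) : ℝ) r (ratOf (α (k + i)))
      rw [abs_sub_comm r] at h2
      linarith [h k, h (k + i)]
    refine (Rat.cast_le (K := ℝ)).1 ?_
    push_cast
    exact h1
  · refine tendsto_iff_norm_sub_tendsto_zero.2
      (squeeze_zero (fun _ => norm_nonneg _) (fun k => h k) ?_)
    exact (tendsto_div_two_pow 1).comp (tendsto_add_atTop_nat 1)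

theorem exists_ratOf_near {p q : ℕ} {x δ : ℝ} (hδ : 0 < δ) (hp : (ratOf p : ℝ) ≤ x)
    (hq : x ≤ ratOf q) : ∃ y : ℕ, ratOf p ≤ ratOf y ∧ ratOf y ≤ ratOf q ∧
      |(ratOf y : ℝ) - x| < δ := by
  -- A rational is sought to the right of `x`; at the right endpoint there is no room, but there `q`
  -- itself serves.
  rcases hq.lt_or_eq with h | h
  · obtain ⟨r, h1, h2⟩ := exists_rat_btwn (lt_min h (lt_add_of_pos_right x hδ))
    obtain ⟨y, rfl⟩ := ratOf_surjective r
    obtain ⟨h3, h4⟩ := lt_min_iff.1 h2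
    refine ⟨y, ?_, ?_, ?_⟩
    · exact_mod_cast hp.trans h1.le
    · exact_mod_cast h3.le
    · rw [abs_lt]
      constructor <;> linarith
  · refine ⟨q, ?_, le_rfl, by simpa [h] using hδ⟩
    rw [h] at hp
    exact_mod_cast hp

/-- The conditions tested along the sequence `g`, where `a` and `b` code triples `⟨n, ⟨m, t⟩⟩`. -/
def Witnesses (F : (ℕ → ℕ) → ℕ) (c p q : ℕ) (g : ℕ → ℕ) : Prop :=
  ∀ a b : ℕ,
    (ratOf p ≤ ratOf (g (a + 1)).unpair.2 ∧ ratOf (g (a + 1)).unpair.2 ≤ ratOf q) ∧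
    ratOf (g (a + 1)).unpair.2 ≤ ratOf (g (b + 1)).unpair.2 +
      (1 / 2 ^ a.unpair.2.unpair.2 + 1 / 2 ^ b.unpair.2.unpair.2) ∧
    (g 0 ≤ a.unpair.1 → (g (a.unpair.1 + 1)).unpair.1 ≤ a.unpair.2.unpair.1 →
      ratOf c ≤ ratOf (F (prepend a.unpair.1 a.unpair.2.unpair.1 a.unpair.2.unpair.2
        fun _ => (g (a + 1)).unpair.2)) + 2 / 2 ^ a.unpair.2.unpair.2)

theorem passes_initSeg_iff (F : (ℕ → ℕ) → ℕ) (c p q : ℕ) (g : ℕ → ℕ) (a b : ℕ) (l : List ℕ)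
    (hl : l = (List.range (Nat.pair a b + 2)).map g) :
    Passes (F (query l)) c p q l ↔
    (ratOf p ≤ ratOf (g (a + 1)).unpair.2 ∧ ratOf (g (a + 1)).unpair.2 ≤ ratOf q) ∧
    ratOf (g (a + 1)).unpair.2 ≤ ratOf (g (b + 1)).unpair.2 +
      (1 / 2 ^ a.unpair.2.unpair.2 + 1 / 2 ^ b.unpair.2.unpair.2) ∧
    (g 0 ≤ a.unpair.1 → (g (a.unpair.1 + 1)).unpair.1 ≤ a.unpair.2.unpair.1 →
      ratOf c ≤ ratOf (F (prepend a.unpair.1 a.unpair.2.unpair.1 a.unpair.2.unpair.2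
        fun _ => (g (a + 1)).unpair.2)) + 2 / 2 ^ a.unpair.2.unpair.2) := by
  have hlen : l.length = Nat.pair a b + 2 := by simp [hl]
  have hf : fstIndex l = a := by simp [fstIndex, hlen]
  have hs : sndIndex l = b := by simp [sndIndex, hlen]
  -- The length exceeds `a + 1`, `b + 1` and `n + 1` (as `n ≤ a ≤ Nat.pair a b`), so the default of
  -- `getD` is never read.
  have hget : ∀ i, i < Nat.pair a b + 2 → l.getD i 0 = g i := by
    intro i hi
    rw [hl, List.getD_eq_getElem _ _ (by simpa using hi)]
    simp
  have ha := hget (a + 1) (by linarith [Nat.left_le_pair a b])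
  have hb := hget (b + 1) (by linarith [Nat.right_le_pair a b])
  have hn := hget (a.unpair.1 + 1) (by linarith [Nat.left_le_pair a b, Nat.unpair_left_le a])
  have h0 := hget 0 (by omega)
  have hlen2 : 2 ≤ l.length := by omega
  simp only [Passes, query, pointAt, boundAt, hf, hs, ha, hb, hn, h0, ratOf_addCode, ratOf_dyadic,
    hlen2, forall_const, Nat.cast_one, Nat.cast_ofNat]

theorem suslin_eq_zero_iff (h : ℕ → ℕ) : suslin h = 0 ↔
    ∃ g : ℕ → ℕ, ∀ n : ℕ, h (Encodable.encode ((List.range n).map g)) = 0 := by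
  unfold suslin
  split_ifs with hg <;> simp [hg]

/-- Each length at least 2 is `Nat.pair a b + 2` for exactly one pair, and shorter segments pass
vacuously; so all segments pass just when all pairs of indices do. -/
theorem suslin_testFun_eq_zero_iff (F : (ℕ → ℕ) → ℕ) (c p q : ℕ) :
    suslin (testFun F c p q) = 0 ↔ ∃ g, Witnesses F c p q g := by
  have h1 : ∀ g : ℕ → ℕ, ∀ n,
      testFun F c p q (Encodable.encode ((List.range n).map g)) = 0 ↔
      Passes (F (query ((List.range n).map g))) c p q ((List.range n).map g) := by
    intro g n
    rw [testFun, seqOf_encode]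
    split_ifs with h <;> simp [h]
  simp only [suslin_eq_zero_iff, h1]
  refine exists_congr fun g => ⟨fun h a b => ?_, fun h n => ?_⟩
  · exact (passes_initSeg_iff F c p q g a b _ rfl).1 (h _)
  · by_cases hn : 2 ≤ n
    · obtain ⟨n, rfl⟩ := Nat.exists_eq_add_of_le' hn
      have h2 := (passes_initSeg_iff F c p q g n.unpair.1 n.unpair.2 _ rfl).2 (h _ _)
      simpa only [Nat.pair_unpair] using h2
    · intro h2
      exact absurd (by simpa using h2) hn

section Represents

variable {F : (ℕ → ℕ) → ℕ} {fs : ℕ → ℕ → C(unitInterval, ℝ)} {p q : ℕ}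

theorem ratOf_mem_unitInterval (h0 : 0 ≤ ratOf p) (h1 : ratOf q ≤ 1) {y : ℕ}
    (hp : ratOf p ≤ ratOf y) (hq : ratOf y ≤ ratOf q) : (ratOf y : ℝ) ∈ unitInterval :=
  ⟨by exact_mod_cast h0.trans hp, by exact_mod_cast hq.trans h1⟩

theorem Represents.abs_sub_le (hF : Represents F fs) (n m t : ℕ) {y : ℕ}
    (hy : (ratOf y : ℝ) ∈ unitInterval) :
    |(ratOf (F (prepend n m t fun _ => y)) : ℝ) - fs n m ⟨ratOf y, hy⟩| ≤ 1 / 2 ^ t :=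
  (hF n m ⟨ratOf y, hy⟩ _ (isName_const y)).abs_sub_le t

theorem Represents.exists_witnesses (hF : Represents F fs) (h0 : 0 ≤ ratOf p) (h1 : ratOf q ≤ 1)
    {c : ℕ} {x : unitInterval} (hpx : (ratOf p : ℝ) ≤ x) (hxq : (x : ℝ) ≤ ratOf q)
    (hx : ∃ N, ∀ n ≥ N, ∃ M, ∀ m ≥ M, (ratOf c : ℝ) ≤ fs n m x) :
    ∃ g, Witnesses F c p q g := by
  obtain ⟨N, hN⟩ := hx
  choose! M hM using hN
  have key : ∀ a : ℕ, ∃ y : ℕ, ∃ hp : ratOf p ≤ ratOf y, ∃ hq : ratOf y ≤ ratOf q,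
      |(ratOf y : ℝ) - x| < 1 / 2 ^ a.unpair.2.unpair.2 ∧
      |fs a.unpair.1 a.unpair.2.unpair.1 ⟨ratOf y, ratOf_mem_unitInterval h0 h1 hp hq⟩ -
        fs a.unpair.1 a.unpair.2.unpair.1 x| < 1 / 2 ^ a.unpair.2.unpair.2 := by
    intro a
    have ht : (0 : ℝ) < 1 / 2 ^ a.unpair.2.unpair.2 := by positivity
    obtain ⟨δ, hδ, hc⟩ := Metric.continuous_iff.1
      (fs a.unpair.1 a.unpair.2.unpair.1).continuous x _ ht
    obtain ⟨y, hp, hq, hy⟩ := exists_ratOf_near (lt_min hδ ht) hpx hxq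
    obtain ⟨hy1, hy2⟩ := lt_min_iff.1 hy
    exact ⟨y, hp, hq, hy2, hc ⟨ratOf y, _⟩ hy1⟩
  choose y hp hq hy hfy using key
  -- Position 0 holds `N`. Position `a + 1` holds the rational for the index `a` and, independently,
  -- the bound `M` for `n = a`.
  refine ⟨fun i => Nat.casesOn i N fun a => Nat.pair (M a) (y a), fun a b => ?_⟩
  simp only [Nat.unpair_pair]
  refine ⟨⟨hp a, hq a⟩, ?_, fun hn hm => ?_⟩
  · have ha := abs_lt.1 (hy a)
    have hb := abs_lt.1 (hy b)
    have : (ratOf (y a) : ℝ) ≤ ratOf (y b) +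
        (1 / 2 ^ a.unpair.2.unpair.2 + 1 / 2 ^ b.unpair.2.unpair.2) := by linarith
    refine (Rat.cast_le (K := ℝ)).1 ?_
    push_cast
    exact this
  · have h2 := abs_le.1 (hF.abs_sub_le a.unpair.1 a.unpair.2.unpair.1 a.unpair.2.unpair.2
      (ratOf_mem_unitInterval h0 h1 (hp a) (hq a)))
    have h3 := abs_lt.1 (hfy a)
    have h4 := hM _ hn _ hm
    -- One half of the slack covers the error of `F`, the other the change of `f_{n,m}` from `x` to
    -- the rational.
    have h5 : (2 : ℝ) / 2 ^ a.unpair.2.unpair.2 =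
      1 / 2 ^ a.unpair.2.unpair.2 + 1 / 2 ^ a.unpair.2.unpair.2 := by ring
    have : (ratOf c : ℝ) ≤ ratOf (F (prepend a.unpair.1 a.unpair.2.unpair.1
        a.unpair.2.unpair.2 fun _ => y a)) + 2 / 2 ^ a.unpair.2.unpair.2 := by linarith
    refine (Rat.cast_le (K := ℝ)).1 ?_
    push_cast
    exact this

theorem Represents.exists_point_of_witnesses (hF : Represents F fs) (h0 : 0 ≤ ratOf p)
    (h1 : ratOf q ≤ 1) {c : ℕ} {g : ℕ → ℕ} (hg : Witnesses F c p q g) :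
    ∃ x : unitInterval, (ratOf p : ℝ) ≤ x ∧ (x : ℝ) ≤ ratOf q ∧
      ∃ N, ∀ n ≥ N, ∃ M, ∀ m ≥ M, (ratOf c : ℝ) ≤ fs n m x := by
  set u : ℕ → ℝ := fun a => (ratOf (g (a + 1)).unpair.2 : ℝ) with hu
  have hpu : ∀ a, (ratOf p : ℝ) ≤ u a := fun a => Rat.cast_le.2 (hg a 0).1.1
  have huq : ∀ a, u a ≤ (ratOf q : ℝ) := fun a => Rat.cast_le.2 (hg a 0).1.2
  have hle : ∀ a b, u a ≤ u b + (1 / 2 ^ a.unpair.2.unpair.2 + 1 / 2 ^ b.unpair.2.unpair.2) :=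
    fun a b => by
      have h := (Rat.cast_le (K := ℝ)).2 (hg a b).2.1
      push_cast at h
      exact h
  have habs : ∀ a b, |u a - u b| ≤ 1 / 2 ^ a.unpair.2.unpair.2 + 1 / 2 ^ b.unpair.2.unpair.2 :=
    fun a b => abs_le.2 ⟨by linarith [hle b a], by linarith [hle a b]⟩
  -- The Cauchy condition ties together all indices, so the guesses for `n = m = 0` already
  -- determine the point; `hnear` then extends the convergence to all `n`, `m`.
  have hcauchy : CauchySeq fun t => u (Nat.pair 0 (Nat.pair 0 t)) := by
    refine cauchySeq_of_le_tendsto_0 (fun t : ℕ => (2 : ℝ) / 2 ^ t) (fun s t T hs ht => ?_)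
      (tendsto_div_two_pow 2)
    have h := habs (Nat.pair 0 (Nat.pair 0 s)) (Nat.pair 0 (Nat.pair 0 t))
    simp only [Nat.unpair_pair] at h
    have hs' : (1 : ℝ) / 2 ^ s ≤ 1 / 2 ^ T :=
      one_div_le_one_div_of_le (by positivity) (pow_le_pow_right₀ (by norm_num) hs)
    have ht' : (1 : ℝ) / 2 ^ t ≤ 1 / 2 ^ T :=
      one_div_le_one_div_of_le (by positivity) (pow_le_pow_right₀ (by norm_num) ht)
    have h2 : (2 : ℝ) / 2 ^ T = 1 / 2 ^ T + 1 / 2 ^ T := by ring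
    rw [Real.dist_eq]
    linarith
  obtain ⟨x, hx⟩ := cauchySeq_tendsto_of_complete hcauchy
  have hpx : (ratOf p : ℝ) ≤ x := ge_of_tendsto' hx fun t => hpu _
  have hxq : x ≤ (ratOf q : ℝ) := le_of_tendsto' hx fun t => huq _
  have hnear : ∀ a, |u a - x| ≤ 1 / 2 ^ a.unpair.2.unpair.2 := by
    intro a
    have h2 := (tendsto_div_two_pow 1).const_add (1 / 2 ^ a.unpair.2.unpair.2)
    rw [add_zero] at h2
    refine le_of_tendsto_of_tendsto' ((tendsto_const_nhds.sub hx).abs) h2 fun s => ?_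
    simpa using habs a (Nat.pair 0 (Nat.pair 0 s))
  have h0' : (0 : ℝ) ≤ ratOf p := by exact_mod_cast h0
  have h1' : (ratOf q : ℝ) ≤ 1 := by exact_mod_cast h1
  have hmem : ∀ a, u a ∈ unitInterval := fun a => ⟨h0'.trans (hpu a), (huq a).trans h1'⟩
  refine ⟨⟨x, h0'.trans hpx, hxq.trans h1'⟩, hpx, hxq, g 0, fun n hn =>
    ⟨(g (n + 1)).unpair.1, fun m hm => ?_⟩⟩
  have hlim : Tendsto (fun t => u (Nat.pair n (Nat.pair m t))) atTop (𝓝 x) := by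
    refine tendsto_iff_norm_sub_tendsto_zero.2
      (squeeze_zero (fun _ => norm_nonneg _) (fun t => ?_) (tendsto_div_two_pow 1))
    simpa using hnear (Nat.pair n (Nat.pair m t))
  have hlim' : Tendsto (fun t => (⟨u (Nat.pair n (Nat.pair m t)), hmem _⟩ : unitInterval)) atTop
      (𝓝 ⟨x, h0'.trans hpx, hxq.trans h1'⟩) := tendsto_subtype_rng.2 hlim
  -- The constant 3 is the slack 2 of the test plus 1 for the error of `F`.
  have hfs := (((fs n m).continuous.tendsto _).comp hlim').add (tendsto_div_two_pow 3)
  rw [add_zero] at hfs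
  refine ge_of_tendsto' hfs fun t => ?_
  have h2 := (hg (Nat.pair n (Nat.pair m t)) 0).2.2
  simp only [Nat.unpair_pair] at h2
  have h3 : (ratOf c : ℝ) ≤ ratOf (F (prepend n m t
      fun _ => (g (Nat.pair n (Nat.pair m t) + 1)).unpair.2)) + 2 / 2 ^ t := by
    have h := (Rat.cast_le (K := ℝ)).2 (h2 hn hm)
    push_cast at h
    exact h
  have h4 := abs_le.1 (hF.abs_sub_le n m t (hmem (Nat.pair n (Nat.pair m t))))
  have h5 : (3 : ℝ) / 2 ^ t = 2 / 2 ^ t + 1 / 2 ^ t := by ring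
  have h6 : (ratOf c : ℝ) ≤ fs n m ⟨u (Nat.pair n (Nat.pair m t)), hmem _⟩ + 3 / 2 ^ t := by
    linarith
  exact h6

variable {f : unitInterval → ℝ}

theorem suslin_testFun_of_lt (hlim : IsRepeatedLimit fs f) (hF : Represents F fs)
    (h0 : 0 ≤ ratOf p) (h1 : ratOf q ≤ 1) {c : ℕ} {x : unitInterval} (hpx : (ratOf p : ℝ) ≤ x)
    (hxq : (x : ℝ) ≤ ratOf q) (hc : (ratOf c : ℝ) < f x) : suslin (testFun F c p q) = 0 := by
  obtain ⟨g, hg, hgf⟩ := hlim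
  refine (suslin_testFun_eq_zero_iff F c p q).2 (hF.exists_witnesses h0 h1 hpx hxq ?_)
  obtain ⟨N, hN⟩ := eventually_atTop.1 ((hgf x).eventually_const_lt hc)
  refine ⟨N, fun n hn => ?_⟩
  obtain ⟨M, hM⟩ := eventually_atTop.1 ((hg n x).eventually_const_lt (hN n hn))
  exact ⟨M, fun m hm => (hM m hm).le⟩

theorem exists_le_of_suslin_testFun (hlim : IsRepeatedLimit fs f) (hF : Represents F fs)
    (h0 : 0 ≤ ratOf p) (h1 : ratOf q ≤ 1) {c : ℕ} (hc : suslin (testFun F c p q) = 0) :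
    ∃ x : unitInterval, (ratOf p : ℝ) ≤ x ∧ (x : ℝ) ≤ ratOf q ∧ (ratOf c : ℝ) ≤ f x := by
  obtain ⟨g, hg, hgf⟩ := hlim
  obtain ⟨w, hw⟩ := (suslin_testFun_eq_zero_iff F c p q).1 hc
  obtain ⟨x, hpx, hxq, N, hN⟩ := hF.exists_point_of_witnesses h0 h1 hw
  refine ⟨x, hpx, hxq, ge_of_tendsto (hgf x) (eventually_atTop.2 ⟨N, fun n hn => ?_⟩)⟩
  obtain ⟨M, hM⟩ := hN n hn
  exact ge_of_tendsto (hg n x) (eventually_atTop.2 ⟨M, hM⟩)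

end Represents

/-- Acceptance is not needed to be monotone in the grid point: the search runs downwards, so
everything above its result was rejected. -/
theorem supIndex_spec (F : (ℕ → ℕ) → ℕ) (p q k N : ℕ) :
    supIndex F p q k N ≤ N ∧
    (supIndex F p q k N = 0 ∨
      suslin (testFun F (dyadic (supIndex F p q k N) (k + 1)) p q) = 0) ∧
    ∀ b, supIndex F p q k N < b → b ≤ N → suslin (testFun F (dyadic b (k + 1)) p q) ≠ 0 := by
  induction N with
  | zero => exact ⟨le_rfl, Or.inl rfl, fun b h1 h2 => absurd h2 (by omega)⟩
  | succ N ih =>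
    obtain ⟨ih1, ih2, ih3⟩ := ih
    by_cases h : suslin (testFun F (dyadic (N + 1) (k + 1)) p q) = 0
    · have he : supIndex F p q k (N + 1) = N + 1 := if_pos h
      rw [he]
      exact ⟨le_rfl, Or.inr h, fun b h1 h2 => absurd h2 (by omega)⟩
    · have he : supIndex F p q k (N + 1) = supIndex F p q k N := if_neg h
      rw [he]
      refine ⟨by omega, ih2, fun b h1 h2 => ?_⟩
      rcases Nat.le_succ_iff.1 h2 with h3 | rfl
      · exact ih3 b h1 h3
      · exact h

end HigherType

/-! ### The main theorem -/

open HigherType in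
theorem mainTheorem6 :
    ∃ e : ℕ, ∀ (f : unitInterval → unitInterval) (fs : ℕ → ℕ → C(unitInterval, ℝ)),
      HigherType.IsRepeatedLimit fs (fun x => (f x : ℝ)) →
      ∀ F : (ℕ → ℕ) → ℕ, HigherType.Represents F fs →
      ∀ p q : ℕ, 0 ≤ HigherType.ratOf p → HigherType.ratOf p ≤ HigherType.ratOf q →
        HigherType.ratOf q ≤ 1 →
      ∃ α : ℕ → ℕ,
        (∀ k : ℕ, HigherType.Computes e
          [HigherType.arg2 HigherType.suslin, HigherType.arg2 F,
            HigherType.arg0 p, HigherType.arg0 q, HigherType.arg0 k] (α k)) ∧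
        ∃ s : ℝ,
          IsLUB {y : ℝ | ∃ x : unitInterval, (HigherType.ratOf p : ℝ) ≤ (x : ℝ) ∧
            (x : ℝ) ≤ (HigherType.ratOf q : ℝ) ∧ y = (f x : ℝ)} s ∧
          HigherType.IsName α s := by
  obtain ⟨e, he⟩ := computes_supName
  refine ⟨e, fun f fs hlim F hF p q h0 hpq h1 => ⟨supName F p q, he F p q, ?_⟩⟩
  obtain ⟨s, hlub⟩ := Real.exists_isLUB
    (s := {y : ℝ | ∃ x : unitInterval, (ratOf p : ℝ) ≤ (x : ℝ) ∧ (x : ℝ) ≤ (ratOf q : ℝ) ∧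
      y = (f x : ℝ)})
    ⟨_, ⟨ratOf p, ratOf_mem_unitInterval h0 h1 le_rfl hpq⟩, le_rfl, Rat.cast_le.2 hpq, rfl⟩
    ⟨1, by rintro _ ⟨x, -, -, rfl⟩; exact (f x).2.2⟩
  refine ⟨s, hlub, isName_of_abs_sub_le fun k => ?_⟩
  obtain ⟨hN, hacc, hrej⟩ := supIndex_spec F p q k (2 ^ (k + 1))
  have hname : ratOf (supName F p q k) = supIndex F p q k (2 ^ (k + 1)) / 2 ^ (k + 1) :=
    ratOf_dyadic _ _
  generalize supIndex F p q k (2 ^ (k + 1)) = a at hN hacc hrej hname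
  have hname' : (ratOf (supName F p q k) : ℝ) = a / 2 ^ (k + 1) := by rw [hname]; push_cast; rfl
  have hd : ∀ b, (ratOf (dyadic b (k + 1)) : ℝ) = b / 2 ^ (k + 1) := fun b => by
    rw [ratOf_dyadic]; push_cast; rfl
  have hlow : (a : ℝ) / 2 ^ (k + 1) ≤ s := by
    -- The result 0 need not have been accepted, but `f ≥ 0` makes it a lower bound anyway.
    rcases hacc with rfl | h
    · have := hlub.1 ⟨⟨ratOf p, ratOf_mem_unitInterval h0 h1 le_rfl hpq⟩, le_rfl,
        Rat.cast_le.2 hpq, rfl⟩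
      simpa using (f _).2.1.trans this
    · obtain ⟨x, hpx, hxq, hx⟩ := exists_le_of_suslin_testFun hlim hF h0 h1 h
      rw [hd] at hx
      exact hx.trans (hlub.1 ⟨x, hpx, hxq, rfl⟩)
  have hup : s ≤ (a : ℝ) / 2 ^ (k + 1) + 1 / 2 ^ (k + 1) := by
    refine hlub.2 ?_
    rintro _ ⟨x, hpx, hxq, rfl⟩
    rw [← add_div]
    -- Below the top of the grid, `a + 1` was rejected, so no value exceeds it; at the top, `f ≤ 1`
    -- suffices.
    rcases hN.lt_or_eq with h | h
    · by_contra hlt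
      refine hrej (a + 1) (by omega) h (suslin_testFun_of_lt hlim hF h0 h1 hpx hxq ?_)
      rw [hd]
      push_cast
      exact not_le.1 hlt
    · refine (f x).2.2.trans ?_
      rw [one_le_div (by positivity), h]
      push_cast
      linarith
  rw [hname', abs_le]
  constructor <;> linarith [show (0 : ℝ) ≤ 1 / 2 ^ (k + 1) by positivity]
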